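/- Let $d\ge 8$. An algebraic $\mathbb{Z}^d$-action on a compact (Hausdorff) abelian group $X$ is a homomorphism $\alpha$ from $\mathbb{Z}^d$ to the group of continuous automorphisms of $X$; mixing and entropy are taken with respect to the normalized Haar measure $\lambda_X$. A measurable map $\phi: X\to Y$ between compact abelian groups is called affine if there are $c\in Y$ and a continuous surjective homomorphism $\theta: X\to Y$ with $\phi(x)=c+\theta(x)$ for $\lambda_X$-almost every $x$. Then there exist a compact zero-dimensional abelian group $X$, a mixing algebraic $\mathbb{Z}^d$-action $\alpha$ on $X$ with entropy $h(\alpha)=0$, and a homeomorphism $f: X\to X$ which is not affine, preserves $\lambda_X$, and satisfies $f\circ\alpha(\mathbf{n})=\alpha(\mathbf{n})\circ f$ for all $\mathbf{n}\in\mathbb{Z}^d$. Consequently Schmidt's isomorphism-rigidity conjecture fails for every $d\ge 8$. That is, the following assertion is false: if $\alpha$ and $\beta$ are mixing algebraic $\mathbb{Z}^d$-actions on compact abelian groups $X$ and $Y$ with $h(\alpha)=0$, then every measurable conjugacy $\phi: X\to Y$ of $\alpha$ and $\beta$ (an isomorphism of the measure spaces $(X,\lambda_X)$ and $(Y,\lambda_Y)$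 with $\phi\circ\alpha(\mathbf{n})=\beta(\mathbf{n})\circ\phi$ $\lambda_X$-almost everywhere for each $\mathbf{n}\in\mathbb{Z}^d$) is affine. -/

import Mathlib

open MeasureTheory Filter Topology
open scoped ENNReal

/-- An algebraic `ℤ^d`-action on a topological abelian group `X`: a homomorphism from `ℤ^d` to the
group of continuous automorphisms of `X`. -/
structure AlgebraicAction (d : ℕ) (X : Type*) [AddCommGroup X] [TopologicalSpace X] where
  /-- The automorphism by which an element of `ℤ^d` acts. -/
  toAut : (Fin d → ℤ) → (X ≃ₜ+ X)
  map_zero : ∀ x : X, toAut 0 x = x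
  map_add : ∀ (m n : Fin d → ℤ) (x : X), toAut (m + n) x = toAut m (toAut n x)

/-- The Haar measure of a compact abelian group, normalized to have total mass `1`. -/
noncomputable def haarProb (X : Type*) [AddCommGroup X] [TopologicalSpace X]
    [IsTopologicalAddGroup X] [CompactSpace X] [MeasurableSpace X] [BorelSpace X] : Measure X :=
  Measure.addHaarMeasure (⊤ : TopologicalSpace.PositiveCompacts X)

/-- Zero-dimensional space: the clopen sets form a base of the topology. -/
def IsZeroDimensional (X : Type*) [TopologicalSpace X] : Prop :=
  TopologicalSpace.IsTopologicalBasis {s : Set X | IsClopen s}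

/-- The Shannon entropy `∑_a -μ(P = a) log μ(P = a)` of a partition, given as a labelling `P` of
the points by a finite set `ι`. -/
noncomputable def partitionEntropy {X ι : Type*} [MeasurableSpace X] [Fintype ι]
    (μ : Measure X) (P : X → ι) : ℝ :=
  ∑ a : ι, Real.negMulLog (μ.real (P ⁻¹' {a}))

section

variable {d : ℕ} {X Y : Type*}
  [AddCommGroup X] [TopologicalSpace X] [IsTopologicalAddGroup X] [CompactSpace X]
  [MeasurableSpace X] [BorelSpace X]
  [AddCommGroup Y] [TopologicalSpace Y] [IsTopologicalAddGroup Y] [CompactSpace Y]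
  [MeasurableSpace Y] [BorelSpace Y]

/-- The action is mixing for Haar measure `λ`: `λ(A ∩ α(n)⁻¹ B) → λ(A) λ(B)` as `n → ∞` in `ℤ^d`,
for all measurable `A` and `B`. -/
def AlgebraicAction.IsMixing (α : AlgebraicAction d X) : Prop :=
  ∀ A B : Set X, MeasurableSet A → MeasurableSet B →
    Tendsto (fun n : Fin d → ℤ => haarProb X (A ∩ α.toAut n ⁻¹' B)) cofinite
      (𝓝 (haarProb X A * haarProb X B))

/-- The common refinement of the partitions `α(n)⁻¹ P`, for `n` in the box `{0, …, N - 1}^d`,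
given by the labelling of a point `x` by the family of the labels of the points `α(n) x`. -/
def AlgebraicAction.refine (α : AlgebraicAction d X) {k : ℕ} (P : X → Fin k) (N : ℕ) :
    X → ((Fin d → Fin N) → Fin k) :=
  fun x n => P (α.toAut (fun i => ((n i : ℕ) : ℤ)) x)

/-- The (measure-theoretic, Kolmogorov-Sinai) entropy `h(α)` with respect to Haar measure: the
supremum over all finite measurable partitions `P` of the limit, as `N → ∞`, of `N^(-d)` times the
Shannon entropy of the refinement of `P` over the box of side `N`. -/
noncomputable def AlgebraicAction.entropy (α : AlgebraicAction d X) : ℝ≥0∞ :=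
  ⨆ (k : ℕ) (P : X → Fin k) (_ : Measurable P),
    limsup (fun N : ℕ =>
      ENNReal.ofReal (partitionEntropy (haarProb X) (α.refine P N) / (N : ℝ) ^ d)) atTop

/-- A map between compact abelian groups is affine if it agrees almost everywhere, for Haar
measure, with `x ↦ c + θ x`, for a constant `c` and a continuous surjective homomorphism `θ`. -/
def IsAffineMap (f : X → Y) : Prop :=
  ∃ (c : Y) (θ : X →ₜ+ Y), Function.Surjective θ ∧ ∀ᵐ x ∂(haarProb X), f x = c + θ x

/-- A measurable conjugacy of two algebraic `ℤ^d`-actions: an isomorphism of measure spaces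
(measurable, measure preserving, with a measurable inverse almost everywhere) that intertwines the
two actions almost everywhere. -/
structure IsMeasurableConjugacy (α : AlgebraicAction d X) (β : AlgebraicAction d Y)
    (φ : X → Y) : Prop where
  measurePreserving : MeasurePreserving φ (haarProb X) (haarProb Y)
  exists_inverse : ∃ ψ : Y → X, Measurable ψ ∧
    (∀ᵐ x ∂(haarProb X), ψ (φ x) = x) ∧ ∀ᵐ y ∂(haarProb Y), φ (ψ y) = y
  equivariant : ∀ n : Fin d → ℤ, ∀ᵐ x ∂(haarProb X), φ (α.toAut n x) = β.toAut n (φ x)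

end

/-- The isomorphism-rigidity property conjectured by Schmidt, for a given `d`: every measurable
conjugacy between mixing algebraic `ℤ^d`-actions on compact abelian groups, the first of which has
zero entropy, is almost everywhere equal to an affine map. -/
def IsomorphismRigidity (d : ℕ) : Prop :=
  ∀ (X Y : Type)
    [AddCommGroup X] [TopologicalSpace X] [IsTopologicalAddGroup X] [CompactSpace X] [T2Space X]
    [MeasurableSpace X] [BorelSpace X]
    [AddCommGroup Y] [TopologicalSpace Y] [IsTopologicalAddGroup Y] [CompactSpace Y] [T2Space Y]
    [MeasurableSpace Y] [BorelSpace Y]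
    (α : AlgebraicAction d X) (β : AlgebraicAction d Y),
    α.IsMixing → β.IsMixing → α.entropy = 0 →
      ∀ φ : X → Y, IsMeasurableConjugacy α β φ → IsAffineMap φ

/-! Fix a prime `p ≥ d`, let `V = 𝔽_p(t)`, and let the `i`-th basis vector of `ℤ^d` act by
multiplication by `t - i`. The space `X` is the compact dual of `V × (V ⊗ V)` under the diagonal
action. A point is a pair `(χ, β)` of functionals on the two summands, and the counterexample is the
shear `(χ, β) ↦ (χ, β + χ ⊗ χ)`. It is equivariant because `χ ↦ χ ⊗ χ` is natural. It preserves Haar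
measure because it translates each fibre over `χ` by an amount depending only on `χ`. It is not
affine for odd `p`, being genuinely quadratic in `χ`.

Mixing reduces to the absence of nonzero periodic vectors in the dual module
(`isMixing_dualAction`). In `V` this is the multiplicative independence of the factors `t - i`, by
unique factorization. It passes to `V ⊗ V` by contracting against functionals: over a finite field
the contractions of one tensor form a finite set (`eq_zero_of_tensorMap_eq`).

Zero entropy is a dimension count. Over a box of side `N` the orbit of a rational function spans
dimension `O(N)`, since degrees grow linearly, so the orbit of a tensor spans `O(N^2)`. A partition
depending on finitely many coordinates then has entropy `O(N^2) = o(N^d)` over the box, and such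
partitions approximate all others (`entropy_dualAction_eq_zero`). -/

/-! ### Shannon entropy of finite partitions. -/

section Entropy

variable {Ω ι κ : Type*} [MeasurableSpace Ω] [Fintype ι] {μ : Measure Ω}

theorem measureReal_preimage_comp_singleton [IsProbabilityMeasure μ] [DecidableEq κ] {P : Ω → ι}
    (hP : ∀ a, MeasurableSet (P ⁻¹' {a})) (g : ι → κ) (b : κ) :
    μ.real ((fun x => g (P x)) ⁻¹' {b}) = ∑ a with g a = b, μ.real (P ⁻¹' {a}) := by
  rw [sum_measureReal_preimage_singleton _ fun a _ => hP a]
  congr 1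
  ext x
  simp

variable [Fintype κ]

theorem sum_measureReal_mul_comp [IsProbabilityMeasure μ] {P : Ω → ι}
    (hP : ∀ a, MeasurableSet (P ⁻¹' {a})) (g : ι → κ) (φ : κ → ℝ) :
    ∑ a, μ.real (P ⁻¹' {a}) * φ (g a) =
      ∑ b, μ.real ((fun x => g (P x)) ⁻¹' {b}) * φ b := by
  classical
  rw [← Finset.sum_fiberwise (s := Finset.univ) (g := g)]
  refine Finset.sum_congr rfl fun b _ => ?_
  rw [measureReal_preimage_comp_singleton hP, Finset.sum_mul]
  refine Finset.sum_congr rfl fun a ha => ?_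
  rw [(Finset.mem_filter.1 ha).2]

theorem sum_measureReal_preimage_eq_one [IsProbabilityMeasure μ] {P : Ω → ι}
    (hP : ∀ a, MeasurableSet (P ⁻¹' {a})) : ∑ a, μ.real (P ⁻¹' {a}) = 1 := by
  rw [sum_measureReal_preimage_singleton _ fun a _ => hP a]
  simp

/-- Gibbs' inequality, from `log x ≤ x - 1` at `x = q a / μ(P = a)`. Uniform `q` gives the
cardinality bound, and products of marginals give subadditivity. -/
theorem partitionEntropy_le_sum_mul_neg_log [IsProbabilityMeasure μ] {P : Ω → ι}
    (hP : ∀ a, MeasurableSet (P ⁻¹' {a})) (q : ι → ℝ) (hq0 : ∀ a, 0 ≤ q a)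
    (hqP : ∀ a, q a = 0 → μ.real (P ⁻¹' {a}) = 0) (hq : ∑ a, q a ≤ 1) :
    partitionEntropy μ P ≤ ∑ a, μ.real (P ⁻¹' {a}) * -Real.log (q a) := by
  have key : ∀ a, Real.negMulLog (μ.real (P ⁻¹' {a})) - μ.real (P ⁻¹' {a}) * -Real.log (q a) ≤
      q a - μ.real (P ⁻¹' {a}) := by
    intro a
    rcases (measureReal_nonneg (μ := μ) (s := P ⁻¹' {a})).eq_or_lt with h | h
    · simp [← h, hq0 a]
    · have hqa : 0 < q a := (hq0 a).lt_of_ne fun h' => h.ne' (hqP a h'.symm)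
      have h1 := Real.log_le_sub_one_of_pos (div_pos hqa h)
      rw [Real.log_div hqa.ne' h.ne'] at h1
      have h2 := mul_le_mul_of_nonneg_left h1 h.le
      rw [mul_sub, mul_sub, mul_div_cancel₀ _ h.ne'] at h2
      rw [Real.negMulLog]
      linarith
  have := Finset.sum_le_sum fun a (_ : a ∈ Finset.univ) => key a
  rw [Finset.sum_sub_distrib, Finset.sum_sub_distrib, sum_measureReal_preimage_eq_one hP] at this
  rw [partitionEntropy]
  linarith

theorem partitionEntropy_nonneg [IsProbabilityMeasure μ] (P : Ω → ι) :
    0 ≤ partitionEntropy μ P :=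
  Finset.sum_nonneg fun _ _ => Real.negMulLog_nonneg measureReal_nonneg measureReal_le_one

theorem partitionEntropy_le_log_card [IsProbabilityMeasure μ] {P : Ω → ι}
    (hP : ∀ a, MeasurableSet (P ⁻¹' {a})) :
    partitionEntropy μ P ≤ Real.log (Fintype.card ι) := by
  have hι : Nonempty ι := (μ.nonempty_of_neZero).map P
  have hc : (0 : ℝ) < Fintype.card ι := by exact_mod_cast Fintype.card_pos
  refine (partitionEntropy_le_sum_mul_neg_log hP (fun _ => (Fintype.card ι : ℝ)⁻¹)
    (fun _ => by positivity) (fun a h => absurd h (by positivity)) ?_).trans ?_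
  · simp [hc.ne']
  · rw [← Finset.sum_mul, sum_measureReal_preimage_eq_one hP]
    simp

/-- Each cell of `P` lies in a cell of the coarser partition, so its `-log` measure can only drop.
-/
theorem partitionEntropy_comp_le [IsProbabilityMeasure μ] {P : Ω → ι}
    (hP : ∀ a, MeasurableSet (P ⁻¹' {a})) (g : ι → κ) :
    partitionEntropy μ (fun x => g (P x)) ≤ partitionEntropy μ P := by
  have h : partitionEntropy μ (fun x => g (P x)) = ∑ a, μ.real (P ⁻¹' {a}) *
      -Real.log (μ.real ((fun x => g (P x)) ⁻¹' {g a})) := by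
    rw [sum_measureReal_mul_comp hP g
      (fun b => -Real.log (μ.real ((fun x => g (P x)) ⁻¹' {b})))]
    exact Finset.sum_congr rfl fun b _ => by rw [Real.negMulLog]; ring
  rw [h, partitionEntropy]
  refine Finset.sum_le_sum fun a _ => ?_
  rw [Real.negMulLog]
  rcases (measureReal_nonneg (μ := μ) (s := P ⁻¹' {a})).eq_or_lt with h0 | h0
  · simp [← h0]
  · have h1 : μ.real (P ⁻¹' {a}) ≤ μ.real ((fun x => g (P x)) ⁻¹' {g a}) :=
      measureReal_mono fun x hx => by simp_all
    have := mul_le_mul_of_nonneg_left (Real.log_le_log h0 h1) h0.le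
    linarith

theorem partitionEntropy_le_of_factors [IsProbabilityMeasure μ] {P : Ω → ι} {Q : Ω → κ}
    (hP : ∀ a, MeasurableSet (P ⁻¹' {a})) (h : ∀ x y, P x = P y → Q x = Q y) :
    partitionEntropy μ Q ≤ partitionEntropy μ P := by
  have : Nonempty κ := (μ.nonempty_of_neZero).map Q
  obtain ⟨g, rfl⟩ := (Function.factorsThrough_iff Q).1 fun x y => h x y
  exact partitionEntropy_comp_le hP g

theorem partitionEntropy_pi_le [IsProbabilityMeasure μ] {J : Type*} [Fintype J] [DecidableEq J]
    {P : Ω → J → ι} (hP : ∀ a, MeasurableSet (P ⁻¹' {a})) :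
    partitionEntropy μ P ≤ ∑ j, partitionEntropy μ (fun x => P x j) := by
  classical
  set q : J → ι → ℝ := fun j b => μ.real ((fun x => P x j) ⁻¹' {b}) with hq
  have hle : ∀ a j, μ.real (P ⁻¹' {a}) ≤ q j (a j) := fun a j =>
    measureReal_mono fun x hx => by simp_all
  have hj : ∀ j b, MeasurableSet ((fun x => P x j) ⁻¹' {b}) := by
    intro j b
    have : (fun x => P x j) ⁻¹' {b} = ⋃ a ∈ {a : J → ι | a j = b}, P ⁻¹' {a} := by
      ext x; simp
    rw [this]
    exact MeasurableSet.biUnion (Set.to_countable _) fun a _ => hP a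
  refine (partitionEntropy_le_sum_mul_neg_log hP (fun a => ∏ j, q j (a j))
    (fun a => Finset.prod_nonneg fun j _ => measureReal_nonneg) ?_ ?_).trans_eq ?_
  · intro a ha
    obtain ⟨j, -, h0⟩ := Finset.prod_eq_zero_iff.1 ha
    exact le_antisymm ((hle a j).trans h0.le) measureReal_nonneg
  · have := Finset.prod_univ_sum (fun _ : J => (Finset.univ : Finset ι)) (fun j b => q j b)
    rw [Fintype.piFinset_univ] at this
    rw [← this]
    simp [hq, sum_measureReal_preimage_eq_one (hj _)]
  · calc ∑ a, μ.real (P ⁻¹' {a}) * -Real.log (∏ j, q j (a j))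
        = ∑ a, ∑ j, μ.real (P ⁻¹' {a}) * -Real.log (q j (a j)) := by
          refine Finset.sum_congr rfl fun a _ => ?_
          rcases (measureReal_nonneg (μ := μ) (s := P ⁻¹' {a})).eq_or_lt with h0 | h0
          · simp [← h0]
          · rw [Real.log_prod fun j _ => (h0.trans_le (hle a j)).ne', ← Finset.sum_neg_distrib,
              Finset.mul_sum]
      _ = ∑ j, ∑ a, μ.real (P ⁻¹' {a}) * -Real.log (q j (a j)) := Finset.sum_comm
      _ = _ := by
          refine Finset.sum_congr rfl fun j _ => ?_
          rw [sum_measureReal_mul_comp hP (fun a => a j) (fun b => -Real.log (q j b))]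
          exact Finset.sum_congr rfl fun b _ => by simp only [hq, Real.negMulLog]; ring

theorem partitionEntropy_prodMk_le [IsProbabilityMeasure μ] {P : Ω → ι} {Q : Ω → κ}
    (hP : ∀ a, MeasurableSet (P ⁻¹' {a})) (hQ : ∀ a, MeasurableSet (Q ⁻¹' {a})) :
    partitionEntropy μ (fun x => (P x, Q x)) ≤ partitionEntropy μ P + partitionEntropy μ Q := by
  have hPQ : ∀ a, MeasurableSet ((fun x => (P x, Q x)) ⁻¹' {a}) := fun a => by
    have : (fun x => (P x, Q x)) ⁻¹' {a} = P ⁻¹' {a.1} ∩ Q ⁻¹' {a.2} := by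
      ext x; simp [Prod.ext_iff]
    rw [this]
    exact (hP _).inter (hQ _)
  have hle1 : ∀ a, μ.real ((fun x => (P x, Q x)) ⁻¹' {a}) ≤ μ.real (P ⁻¹' {a.1}) := fun a =>
    measureReal_mono fun x hx => by simp_all [Prod.ext_iff]
  have hle2 : ∀ a, μ.real ((fun x => (P x, Q x)) ⁻¹' {a}) ≤ μ.real (Q ⁻¹' {a.2}) := fun a =>
    measureReal_mono fun x hx => by simp_all [Prod.ext_iff]
  refine (partitionEntropy_le_sum_mul_neg_log hPQ
    (fun a => μ.real (P ⁻¹' {a.1}) * μ.real (Q ⁻¹' {a.2}))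
    (fun a => by positivity) ?_ ?_).trans_eq ?_
  · intro a ha
    rcases mul_eq_zero.1 ha with h | h
    · exact le_antisymm ((hle1 a).trans h.le) measureReal_nonneg
    · exact le_antisymm ((hle2 a).trans h.le) measureReal_nonneg
  · simp only [Fintype.sum_prod_type, ← Finset.mul_sum, sum_measureReal_preimage_eq_one hP,
      sum_measureReal_preimage_eq_one hQ, mul_one, le_refl]
  · calc _ = ∑ a, (μ.real ((fun x => (P x, Q x)) ⁻¹' {a}) * -Real.log (μ.real (P ⁻¹' {a.1})) +
          μ.real ((fun x => (P x, Q x)) ⁻¹' {a}) * -Real.log (μ.real (Q ⁻¹' {a.2}))) := by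
          refine Finset.sum_congr rfl fun a _ => ?_
          rcases (measureReal_nonneg (μ := μ)
            (s := (fun x => (P x, Q x)) ⁻¹' {a})).eq_or_lt with h0 | h0
          · simp [← h0]
          · rw [Real.log_mul (h0.trans_le (hle1 a)).ne' (h0.trans_le (hle2 a)).ne']
            ring
      _ = _ := by
          rw [Finset.sum_add_distrib,
            sum_measureReal_mul_comp hPQ Prod.fst (fun b => -Real.log (μ.real (P ⁻¹' {b}))),
            sum_measureReal_mul_comp hPQ Prod.snd (fun b => -Real.log (μ.real (Q ⁻¹' {b}))),
            partitionEntropy, partitionEntropy]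
          simp only [Real.negMulLog, neg_mul, mul_neg]

theorem partitionEntropy_comp_measurePreserving [IsProbabilityMeasure μ] {P : Ω → ι} {T : Ω → Ω}
    (hP : ∀ a, MeasurableSet (P ⁻¹' {a})) (hT : MeasurePreserving T μ μ) :
    partitionEntropy μ (fun x => P (T x)) = partitionEntropy μ P :=
  Finset.sum_congr rfl fun a _ => by
    rw [← hT.measureReal_preimage (hP a).nullMeasurableSet]; rfl

/-- A partition with one cell of measure close to `1` has small entropy. -/
theorem exists_pos_partitionEntropy_lt (k : ℕ) {ε : ℝ} (hε : 0 < ε) : ∃ δ > 0,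
    ∀ (μ : Measure Ω) [IsProbabilityMeasure μ] (P : Ω → Fin (k + 1)),
      (∀ a, MeasurableSet (P ⁻¹' {a})) → μ.real (P ⁻¹' {0})ᶜ < δ → partitionEntropy μ P < ε := by
  have h0 := Real.continuous_negMulLog.tendsto 0
  have h1 := Real.continuous_negMulLog.tendsto 1
  rw [Real.negMulLog_zero] at h0
  rw [Real.negMulLog_one] at h1
  have hε' : 0 < ε / (k + 1) := by positivity
  obtain ⟨δ₀, hδ₀, H0⟩ := Metric.eventually_nhds_iff.1 (h0.eventually (gt_mem_nhds hε'))
  obtain ⟨δ₁, hδ₁, H1⟩ := Metric.eventually_nhds_iff.1 (h1.eventually (gt_mem_nhds hε'))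
  refine ⟨min δ₀ δ₁, lt_min hδ₀ hδ₁, fun μ _ P hP h => ?_⟩
  rw [lt_min_iff] at h
  -- Cell `0` has measure near `1` and every other cell measure near `0`; `negMulLog` is continuous
  -- and vanishes at both points.
  have key : ∀ a, Real.negMulLog (μ.real (P ⁻¹' {a})) < ε / (k + 1) := by
    intro a
    by_cases ha : a = 0
    · subst ha
      apply H1
      rw [probReal_compl_eq_one_sub (hP 0)] at h
      rw [Real.dist_eq, abs_sub_comm, abs_of_nonneg (by simp [measureReal_le_one])]
      exact h.2
    · apply H0
      rw [Real.dist_eq, sub_zero, abs_of_nonneg measureReal_nonneg]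
      refine lt_of_le_of_lt (measureReal_mono ?_) h.1
      intro x hx
      simp_all
  calc partitionEntropy μ P < ∑ _a : Fin (k + 1), ε / (k + 1) :=
        Finset.sum_lt_sum_of_nonempty Finset.univ_nonempty fun a _ => key a
    _ = ε := by
        rw [Finset.sum_const, Finset.card_univ, Fintype.card_fin, nsmul_eq_mul]
        push_cast
        field_simp

end Entropy

/-! ### Invariance and independence for Haar measure. -/

section HaarProb

variable (X : Type*) [AddCommGroup X] [TopologicalSpace X]
    [IsTopologicalAddGroup X] [CompactSpace X] [MeasurableSpace X] [BorelSpace X]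

instance haarProb.isAddHaarMeasure : (haarProb X).IsAddHaarMeasure :=
  inferInstanceAs (Measure.addHaarMeasure _).IsAddHaarMeasure

instance haarProb.isProbabilityMeasure : IsProbabilityMeasure (haarProb X) :=
  ⟨Measure.addHaarMeasure_self (K₀ := (⊤ : TopologicalSpace.PositiveCompacts X))⟩

variable {X}

theorem ContinuousAddEquiv.measurePreserving_haarProb (e : X ≃ₜ+ X) :
    MeasurePreserving e (haarProb X) (haarProb X) := by
  have hm : Measurable e := e.continuous.measurable
  refine ⟨hm, ?_⟩
  have h1 : IsProbabilityMeasure ((haarProb X).map e) :=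
    Measure.isProbabilityMeasure_map hm.aemeasurable
  have h2 : ((haarProb X).map e).IsAddHaarMeasure :=
    e.isAddHaarMeasure_map _
  exact Measure.isAddHaarMeasure_eq_of_isProbabilityMeasure _ _

/-- A skew translation along a compact group `H` mapped into `X` preserves Haar measure. -/
theorem measurePreserving_skewTranslation [SecondCountableTopology X] {H : Type*} [AddCommGroup H]
    [TopologicalSpace H] [IsTopologicalAddGroup H] [CompactSpace H] [MeasurableSpace H]
    [BorelSpace H] [SecondCountableTopology H] (j : H →+ X) (hj : Continuous j) (ψ : X → H)
    (hψ : Continuous ψ) (hinv : ∀ x h, ψ (x + j h) = ψ x) :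
    MeasurePreserving (fun x => x + j (ψ x)) (haarProb X) (haarProb X) := by
  have hf : Measurable fun x => x + j (ψ x) :=
    (continuous_id.add (hj.comp hψ)).measurable
  refine ⟨hf, Measure.ext_of_lintegral _ fun g hg => ?_⟩
  rw [lintegral_map hg hf]
  have hm1 : Measurable fun q : X × H => g (q.1 + j q.2 + j (ψ q.1)) :=
    hg.comp (((continuous_fst.add (hj.comp continuous_snd)).add
      (hj.comp (hψ.comp continuous_fst))).measurable)
  have hm2 : Measurable fun q : X × H => g (q.1 + j q.2) :=
    hg.comp ((continuous_fst.add (hj.comp continuous_snd)).measurable)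
  -- Average over translations by `j h`, which do not change `ψ`. After Fubini, for fixed `x` the
  -- shift `ψ x` is absorbed into `h` by invariance on `H`.
  calc ∫⁻ x, g (x + j (ψ x)) ∂haarProb X
      = ∫⁻ _h : H, ∫⁻ x, g (x + j (ψ x)) ∂haarProb X ∂haarProb H := by simp
    _ = ∫⁻ h : H, ∫⁻ x, g (x + j h + j (ψ x)) ∂haarProb X ∂haarProb H := by
        refine lintegral_congr fun h => ?_
        rw [← lintegral_add_right_eq_self (μ := haarProb X) (fun x => g (x + j (ψ x))) (j h)]
        simp only [hinv]
    _ = ∫⁻ x, ∫⁻ h : H, g (x + j h + j (ψ x)) ∂haarProb H ∂haarProb X :=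
        (lintegral_lintegral_swap hm1.aemeasurable).symm
    _ = ∫⁻ x, ∫⁻ h : H, g (x + j h) ∂haarProb H ∂haarProb X := by
        refine lintegral_congr fun x => ?_
        rw [← lintegral_add_right_eq_self (μ := haarProb H) (fun h => g (x + j h)) (ψ x)]
        simp only [map_add, add_assoc]
    _ = ∫⁻ h : H, ∫⁻ x, g (x + j h) ∂haarProb X ∂haarProb H :=
        lintegral_lintegral_swap hm2.aemeasurable
    _ = ∫⁻ _h : H, ∫⁻ x, g x ∂haarProb X ∂haarProb H :=
        lintegral_congr fun h => lintegral_add_right_eq_self _ _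
    _ = ∫⁻ x, g x ∂haarProb X := by simp

/-- Two sets are independent if each translation of the space splits into a translation fixing one
set and a translation fixing the other. -/
theorem haarProb_inter_of_forall_translation [SecondCountableTopology X] {A B : Set X}
    (hA : MeasurableSet A) (hB : MeasurableSet B)
    (h : ∀ y : X, ∃ a b : X, y = a + b ∧ (∀ x, x + a ∈ A ↔ x ∈ A) ∧ ∀ x, x + b ∈ B ↔ x ∈ B) :
    haarProb X (A ∩ B) = haarProb X A * haarProb X B := by
  have hm : Measurable fun q : X × X =>
      A.indicator (1 : X → ℝ≥0∞) q.2 * B.indicator 1 (q.2 + q.1) :=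
    ((measurable_one.indicator hA).comp measurable_snd).mul
      ((measurable_one.indicator hB).comp (measurable_snd.add measurable_fst))
  -- The correlation of `A` with the translate of `B` by `y` does not depend on `y`; averaging it
  -- over `y` yields the product of the measures.
  have key : ∀ y : X, ∫⁻ x, A.indicator (1 : X → ℝ≥0∞) x * B.indicator 1 (x + y) ∂haarProb X =
      haarProb X (A ∩ B) := by
    intro y
    obtain ⟨a, b, rfl, ha, hb⟩ := h y
    rw [← lintegral_indicator_one (hA.inter hB),
      ← lintegral_add_right_eq_self (μ := haarProb X) ((A ∩ B).indicator 1) a]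
    refine lintegral_congr fun x => ?_
    have h1 : x + (a + b) ∈ B ↔ x + a ∈ B := by rw [← add_assoc, hb]
    by_cases hx : x ∈ A <;> by_cases hx' : x + a ∈ B <;>
      simp [Set.indicator, ha, h1, hx, hx']
  calc haarProb X (A ∩ B)
      = ∫⁻ y : X, ∫⁻ x, A.indicator (1 : X → ℝ≥0∞) x * B.indicator 1 (x + y)
          ∂haarProb X ∂haarProb X := by simp [key]
    _ = ∫⁻ x, ∫⁻ y, A.indicator (1 : X → ℝ≥0∞) x * B.indicator 1 (x + y)
          ∂haarProb X ∂haarProb X := lintegral_lintegral_swap hm.aemeasurable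
    _ = ∫⁻ x, A.indicator (1 : X → ℝ≥0∞) x * haarProb X B ∂haarProb X := by
        refine lintegral_congr fun x => ?_
        rw [lintegral_const_mul (f := fun y => B.indicator 1 (x + y)) _
            ((measurable_one.indicator hB).comp (measurable_const_add x)),
          lintegral_add_left_eq_self (μ := haarProb X) (B.indicator 1) x,
          lintegral_indicator_one hB]
    _ = haarProb X A * haarProb X B := by
        rw [lintegral_mul_const _ (measurable_one.indicator hA), lintegral_indicator_one hA]

end HaarProb

/-! ### The compact zero-dimensional dual of an `𝔽_p`-vector space. -/

section DualTopology

variable {p : ℕ} {M : Type*} [AddCommGroup M] [Module (ZMod p) M]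

/-- The topology of pointwise convergence on the dual of an `𝔽_p`-vector space. -/
instance dualTopologicalSpace : TopologicalSpace (M →ₗ[ZMod p] ZMod p) :=
  TopologicalSpace.induced DFunLike.coe inferInstance

instance dualMeasurableSpace : MeasurableSpace (M →ₗ[ZMod p] ZMod p) := borel _

instance dualBorelSpace : BorelSpace (M →ₗ[ZMod p] ZMod p) := ⟨rfl⟩

theorem isClosedEmbedding_dual_coe :
    IsClosedEmbedding (DFunLike.coe : (M →ₗ[ZMod p] ZMod p) → M → ZMod p) where
  eq_induced := rfl
  injective := DFunLike.coe_injective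
  isClosed_range := LinearMap.isClosed_range_coe M (ZMod p) (RingHom.id (ZMod p))

instance dualT2Space : T2Space (M →ₗ[ZMod p] ZMod p) :=
  isClosedEmbedding_dual_coe.isEmbedding.t2Space

instance dualCompactSpace [NeZero p] : CompactSpace (M →ₗ[ZMod p] ZMod p) :=
  isClosedEmbedding_dual_coe.compactSpace

instance dualSecondCountableTopology [NeZero p] [Countable M] :
    SecondCountableTopology (M →ₗ[ZMod p] ZMod p) :=
  isClosedEmbedding_dual_coe.isEmbedding.secondCountableTopology

instance dualIsTopologicalAddGroup : IsTopologicalAddGroup (M →ₗ[ZMod p] ZMod p) :=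
  topologicalAddGroup_induced (LinearMap.ltoFun (ZMod p) M (ZMod p) (ZMod p))

theorem continuous_dual_apply (m : M) :
    Continuous fun χ : M →ₗ[ZMod p] ZMod p => χ m :=
  (continuous_apply m).comp isClosedEmbedding_dual_coe.continuous

theorem continuous_dual_iff {Z : Type*} [TopologicalSpace Z] {g : Z → M →ₗ[ZMod p] ZMod p} :
    Continuous g ↔ ∀ m, Continuous fun z => g z m := by
  rw [isClosedEmbedding_dual_coe.isEmbedding.continuous_iff, continuous_pi_iff]
  rfl

theorem continuous_dual_comp {N : Type*} [AddCommGroup N] [Module (ZMod p) N]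
    (T : N →ₗ[ZMod p] M) : Continuous fun χ : M →ₗ[ZMod p] ZMod p => χ ∘ₗ T :=
  continuous_dual_iff.2 fun n => continuous_dual_apply (T n)

/-- A set of functionals is a cylinder if membership depends on the values at finitely many
vectors. -/
def IsDualCylinder (A : Set (M →ₗ[ZMod p] ZMod p)) : Prop :=
  ∃ s : Finset M, ∀ χ χ' : M →ₗ[ZMod p] ZMod p, (∀ m ∈ s, χ m = χ' m) → (χ ∈ A ↔ χ' ∈ A)

theorem IsDualCylinder.isOpen {A : Set (M →ₗ[ZMod p] ZMod p)} (hA : IsDualCylinder A) :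
    IsOpen A := by
  obtain ⟨s, hs⟩ := hA
  rw [isOpen_iff_mem_nhds]
  intro χ hχ
  have h : ∀ m ∈ s, ∀ᶠ χ' in 𝓝 χ, χ m = χ' m := fun m _ =>
    (((continuous_dual_apply m).tendsto χ).eventually
      ((isOpen_discrete {χ m}).mem_nhds rfl)).mono fun _ h => h.symm
  filter_upwards [(eventually_all_finset s).2 h] with χ' h'
  exact (hs χ χ' h').1 hχ

theorem IsDualCylinder.compl {A : Set (M →ₗ[ZMod p] ZMod p)} (hA : IsDualCylinder A) :
    IsDualCylinder Aᶜ := by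
  obtain ⟨s, hs⟩ := hA
  exact ⟨s, fun χ χ' h => not_congr (hs χ χ' h)⟩

theorem IsDualCylinder.isClopen {A : Set (M →ₗ[ZMod p] ZMod p)} (hA : IsDualCylinder A) :
    IsClopen A :=
  ⟨⟨hA.compl.isOpen⟩, hA.isOpen⟩

theorem IsDualCylinder.union {A B : Set (M →ₗ[ZMod p] ZMod p)} (hA : IsDualCylinder A)
    (hB : IsDualCylinder B) : IsDualCylinder (A ∪ B) := by
  classical
  obtain ⟨s, hs⟩ := hA
  obtain ⟨t, ht⟩ := hB
  exact ⟨s ∪ t, fun χ χ' h => or_congr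
    (hs χ χ' fun m hm => h m (Finset.mem_union_left _ hm))
    (ht χ χ' fun m hm => h m (Finset.mem_union_right _ hm))⟩

theorem isSetRing_isDualCylinder :
    IsSetRing {A : Set (M →ₗ[ZMod p] ZMod p) | IsDualCylinder A} where
  empty_mem := ⟨∅, fun _ _ _ => Iff.rfl⟩
  union_mem _ _ hA hB := IsDualCylinder.union hA hB
  sdiff_mem A B hA hB := by
    have := (IsDualCylinder.union (IsDualCylinder.compl hA) hB).compl
    rwa [Set.compl_union, compl_compl] at this

theorem isTopologicalBasis_isDualCylinder :
    TopologicalSpace.IsTopologicalBasis {A : Set (M →ₗ[ZMod p] ZMod p) | IsDualCylinder A} := by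
  refine TopologicalSpace.isTopologicalBasis_of_isOpen_of_nhds (fun A hA => IsDualCylinder.isOpen hA)
    fun χ U hχ hU => ?_
  obtain ⟨V, hV, rfl⟩ := isOpen_induced_iff.1 hU
  obtain ⟨s, u, hu, hsV⟩ := isOpen_pi_iff.1 hV χ hχ
  refine ⟨{χ' | ∀ m ∈ s, χ' m = χ m}, ⟨s, fun χ₁ χ₂ h => ?_⟩, fun _ _ => rfl, fun χ' h => ?_⟩
  · exact forall₂_congr fun m hm => by rw [h m hm]
  · refine hsV fun m hm => ?_
    have : χ' m = χ m := h m hm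
    rw [this]
    exact (hu m hm).2

theorem isZeroDimensional_dual : IsZeroDimensional (M →ₗ[ZMod p] ZMod p) :=
  isTopologicalBasis_isDualCylinder.of_isOpen_of_subset (fun _ h => h.isOpen)
    fun _ h => IsDualCylinder.isClopen h

/-- Cylinders form a ring of sets and a base of the topology. Countability of `M` makes the dual
second countable, so they generate the Borel sets. -/
theorem exists_isDualCylinder_measure_symmDiff_lt [NeZero p] [Countable M]
    {μ : Measure (M →ₗ[ZMod p] ZMod p)} [IsFiniteMeasure μ] {A : Set (M →ₗ[ZMod p] ZMod p)}
    (hA : MeasurableSet A) {ε : ℝ≥0∞} (hε : 0 < ε) :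
    ∃ C, IsDualCylinder C ∧ μ (symmDiff C A) < ε := by
  refine exists_measure_symmDiff_lt_of_generateFrom_isSetRing isSetRing_isDualCylinder
    ⟨{Set.univ}, Set.countable_singleton _, ?_, ?_⟩ ?_ hA hε
  · rintro _ rfl
    exact ⟨∅, fun _ _ _ => Iff.rfl⟩
  · simp
  · exact isTopologicalBasis_isDualCylinder.borel_eq_generateFrom

end DualTopology

/-! ### Dual actions and mixing. -/

section DualAction

variable {p d : ℕ} {M : Type*} [AddCommGroup M] [Module (ZMod p) M]

/-- The algebraic action on the dual of `M` induced by a `ℤ^d`-action on `M`. -/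
def dualAction (T : Multiplicative (Fin d → ℤ) →* Module.End (ZMod p) M) :
    AlgebraicAction d (M →ₗ[ZMod p] ZMod p) where
  toAut n :=
    { toFun := fun χ => χ ∘ₗ T (.ofAdd n)
      invFun := fun χ => χ ∘ₗ T (.ofAdd (-n))
      left_inv := fun χ => by
        change (χ ∘ₗ T (.ofAdd n)) ∘ₗ T (.ofAdd (-n)) = χ
        rw [LinearMap.comp_assoc, ← Module.End.mul_eq_comp, ← map_mul, ← ofAdd_add]
        simp [Module.End.one_eq_id]
      right_inv := fun χ => by
        change (χ ∘ₗ T (.ofAdd (-n))) ∘ₗ T (.ofAdd n) = χ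
        rw [LinearMap.comp_assoc, ← Module.End.mul_eq_comp, ← map_mul, ← ofAdd_add]
        simp [Module.End.one_eq_id]
      map_add' := fun _ _ => rfl
      continuous_toFun := continuous_dual_comp _
      continuous_invFun := continuous_dual_comp _ }
  map_zero χ := by
    change χ ∘ₗ T 1 = χ
    rw [map_one]
    rfl
  map_add m n χ := by
    change χ ∘ₗ T (.ofAdd (m + n)) = (χ ∘ₗ T (.ofAdd n)) ∘ₗ T (.ofAdd m)
    -- Duality reverses composition; commutativity of `ℤ^d` restores the order.
    rw [add_comm, ofAdd_add, map_mul]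
    rfl

theorem dualAction_toAut_apply (T : Multiplicative (Fin d → ℤ) →* Module.End (ZMod p) M)
    (n : Fin d → ℤ) (χ : M →ₗ[ZMod p] ZMod p) (m : M) :
    (dualAction T).toAut n χ m = χ (T (.ofAdd n) m) :=
  rfl

/-- For each of the finitely many pairs `(w, w')` with `w ≠ 0`, at most one `n` carries `w` to `w'`:
two such would differ by a period of `w`. -/
theorem finite_setOf_not_disjoint_image
    {T : Multiplicative (Fin d → ℤ) →* Module.End (ZMod p) M}
    (hT : ∀ n m, T (.ofAdd n) m = m → n = 0 ∨ m = 0) {W : Set M} (hW : W.Finite) :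
    {n : Fin d → ℤ | ∃ w ∈ W, w ≠ 0 ∧ T (.ofAdd n) w ∈ W}.Finite := by
  have : {n : Fin d → ℤ | ∃ w ∈ W, w ≠ 0 ∧ T (.ofAdd n) w ∈ W} ⊆
      ⋃ q ∈ W ×ˢ W, {n : Fin d → ℤ | q.1 ≠ 0 ∧ T (.ofAdd n) q.1 = q.2} := by
    rintro n ⟨w, hw, h0, hw'⟩
    exact Set.mem_biUnion (x := (w, T (.ofAdd n) w)) ⟨hw, hw'⟩ ⟨h0, rfl⟩
  refine ((hW.prod hW).biUnion fun q _ => Set.Subsingleton.finite ?_).subset this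
  rintro n ⟨h0, hn⟩ m ⟨-, hm⟩
  have : T (.ofAdd (n - m)) q.1 = q.1 := by
    have hsub : n - m = -m + n := by abel
    rw [hsub, ofAdd_add, map_mul, Module.End.mul_apply, hn, ← hm, ← Module.End.mul_apply,
      ← map_mul, ← ofAdd_add]
    simp
  exact sub_eq_zero.1 ((hT _ _ this).resolve_right h0)

/-- Enlarge `V` to a complement of `W`, and let `a` be `y` composed with the projection onto it
along `W`. -/
theorem exists_dual_add_eq_of_disjoint [Fact p.Prime] {V W : Submodule (ZMod p) M}
    (h : Disjoint V W) (y : M →ₗ[ZMod p] ZMod p) :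
    ∃ a b : M →ₗ[ZMod p] ZMod p, y = a + b ∧ (∀ w ∈ W, a w = 0) ∧ ∀ v ∈ V, b v = 0 := by
  obtain ⟨V', hV, hc⟩ := h.exists_isCompl
  refine ⟨y ∘ₗ V'.projection W hc, y - y ∘ₗ V'.projection W hc, by abel, fun w hw => ?_, fun v hv => ?_⟩
  · simp [(Submodule.projection_apply_eq_zero_iff hc).2 hw]
  · simp [(Submodule.projection_apply_left hc ⟨v, hV hv⟩)]

/-- Both cylinders depend on a finite subspace `W`. For all but finitely many `n`, `W` and its image
under `T n` meet only in `0`, so every translation splits as needed for exact independence. -/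
theorem haarProb_inter_preimage_of_isDualCylinder [Fact p.Prime] [Countable M]
    {T : Multiplicative (Fin d → ℤ) →* Module.End (ZMod p) M}
    (hT : ∀ n m, T (.ofAdd n) m = m → n = 0 ∨ m = 0) {A B : Set (M →ₗ[ZMod p] ZMod p)}
    (hA : IsDualCylinder A) (hB : IsDualCylinder B) :
    ∀ᶠ n in cofinite, haarProb _ (A ∩ (dualAction T).toAut n ⁻¹' B) =
      haarProb _ A * haarProb _ B := by
  classical
  obtain ⟨s, hs⟩ := id hA
  obtain ⟨t, ht⟩ := id hB
  set W : Submodule (ZMod p) M := Submodule.span (ZMod p) (s ∪ t : Finset M) with hWdef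
  have hWf : (W : Set M).Finite := by
    have : Module.Finite (ZMod p) W := Module.Finite.span_of_finite _ (Finset.finite_toSet _)
    have := Module.finite_of_finite (ZMod p) (M := W)
    exact Set.toFinite (W : Set M)
  have hev : ∀ᶠ n in cofinite, n ∉ {n : Fin d → ℤ | ∃ w ∈ (W : Set M), w ≠ 0 ∧
      T (.ofAdd n) w ∈ (W : Set M)} := (finite_setOf_not_disjoint_image hT hWf).compl_mem_cofinite
  filter_upwards [hev] with n hn
  have hmeas := hB.isOpen.measurableSet
  rw [← ((dualAction T).toAut n).measurePreserving_haarProb.measure_preimage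
    hmeas.nullMeasurableSet]
  refine haarProb_inter_of_forall_translation hA.isOpen.measurableSet
    (hmeas.preimage ((dualAction T).toAut n).continuous.measurable) fun y => ?_
  have hd : Disjoint (W.map (T (.ofAdd n))) W := by
    rw [Submodule.disjoint_def]
    rintro _ ⟨w, hw, rfl⟩ hw'
    by_contra h0
    exact hn ⟨w, hw, fun h => h0 (by simp [h]), hw'⟩
  obtain ⟨a, b, hab, ha, hb⟩ := exists_dual_add_eq_of_disjoint hd y
  refine ⟨a, b, hab, fun χ => hs _ _ fun m hm => ?_, fun χ => ht _ _ fun m hm => ?_⟩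
  · rw [LinearMap.add_apply, ha m (Submodule.subset_span (by simp [hm])), add_zero]
  · rw [dualAction_toAut_apply, dualAction_toAut_apply, LinearMap.add_apply,
      hb _ (Submodule.mem_map_of_mem (Submodule.subset_span (by simp [hm]))), add_zero]

theorem abs_measureReal_inter_sub_le {Ω : Type*} [MeasurableSpace Ω] {μ : Measure Ω}
    [IsFiniteMeasure μ] {A B C D : Set Ω} (hA : MeasurableSet A) (hB : MeasurableSet B)
    (hC : MeasurableSet C) (hD : MeasurableSet D) :
    |μ.real (A ∩ B) - μ.real (C ∩ D)| ≤ μ.real (symmDiff A C) + μ.real (symmDiff B D) := by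
  refine (abs_measureReal_sub_le_measureReal_symmDiff
    (hA.inter hB).nullMeasurableSet
    (hC.inter hD).nullMeasurableSet).trans
    ((measureReal_mono ?_).trans (measureReal_union_le _ _))
  intro x
  simp only [Set.mem_symmDiff, Set.mem_inter_iff, Set.mem_union]
  tauto

/-- Mixing can be checked on a class of sets which is dense for the measure of the symmetric
difference. -/
theorem tendsto_measure_inter_preimage_of_dense {Ω I : Type*} [MeasurableSpace Ω] {μ : Measure Ω}
    [IsProbabilityMeasure μ] {l : Filter I} {τ : I → Ω → Ω} (hτ : ∀ n, MeasurePreserving (τ n) μ μ)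
    {S : Set (Set Ω)} (hS : ∀ A ∈ S, MeasurableSet A)
    (hdense : ∀ A, MeasurableSet A → ∀ ε : ℝ≥0∞, 0 < ε → ∃ C ∈ S, μ (symmDiff C A) < ε)
    (hmix : ∀ C ∈ S, ∀ D ∈ S, ∀ᶠ n in l, μ (C ∩ τ n ⁻¹' D) = μ C * μ D) {A B : Set Ω}
    (hA : MeasurableSet A) (hB : MeasurableSet B) :
    Tendsto (fun n => μ (A ∩ τ n ⁻¹' B)) l (𝓝 (μ A * μ B)) := by
  rw [← ENNReal.tendsto_toReal_iff (fun _ => measure_ne_top _ _)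
    (ENNReal.mul_ne_top (measure_ne_top _ _) (measure_ne_top _ _)), ENNReal.toReal_mul]
  change Tendsto (fun n => μ.real (A ∩ τ n ⁻¹' B)) l (𝓝 (μ.real A * μ.real B))
  rw [Metric.tendsto_nhds]
  intro ε hε
  -- Each of the two approximation errors is paid twice: in the intersections and in the product of
  -- measures.
  have hδ : 0 < ENNReal.ofReal (ε / 4) := ENNReal.ofReal_pos.2 (by positivity)
  obtain ⟨C, hC, hCA⟩ := hdense A hA _ hδ
  obtain ⟨D, hD, hDB⟩ := hdense B hB _ hδ
  have hCA' : μ.real (symmDiff A C) < ε / 4 := by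
    rw [symmDiff_comm]
    exact (ENNReal.lt_ofReal_iff_toReal_lt (measure_ne_top _ _)).1 hCA
  have hDB' : μ.real (symmDiff B D) < ε / 4 := by
    rw [symmDiff_comm]
    exact (ENNReal.lt_ofReal_iff_toReal_lt (measure_ne_top _ _)).1 hDB
  have hCm := hS C hC
  have hDm := hS D hD
  filter_upwards [hmix C hC D hD] with n hn
  have hn' : μ.real (C ∩ τ n ⁻¹' D) = μ.real C * μ.real D := by
    rw [measureReal_def, hn, ENNReal.toReal_mul, measureReal_def, measureReal_def]
  have h1 := abs_measureReal_inter_sub_le (μ := μ) hA (hB.preimage (hτ n).measurable) hCm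
    (hDm.preimage (hτ n).measurable)
  have h2 : μ.real (symmDiff (τ n ⁻¹' B) (τ n ⁻¹' D)) = μ.real (symmDiff B D) :=
    (hτ n).measureReal_preimage (hB.symmDiff hDm).nullMeasurableSet
  have h3 := abs_measureReal_sub_le_measureReal_symmDiff (μ := μ) hA.nullMeasurableSet
    hCm.nullMeasurableSet
  have h4 := abs_measureReal_sub_le_measureReal_symmDiff (μ := μ) hB.nullMeasurableSet
    hDm.nullMeasurableSet
  have h5 : |μ.real A * μ.real B - μ.real C * μ.real D| ≤
      |μ.real A - μ.real C| + |μ.real B - μ.real D| := by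
    have : μ.real A * μ.real B - μ.real C * μ.real D =
        (μ.real A - μ.real C) * μ.real B + μ.real C * (μ.real B - μ.real D) := by ring
    rw [this]
    refine (abs_add_le _ _).trans (add_le_add ?_ ?_)
    · rw [abs_mul, abs_of_nonneg (measureReal_nonneg (s := B))]
      exact mul_le_of_le_one_right (abs_nonneg _) measureReal_le_one
    · rw [abs_mul, abs_of_nonneg (measureReal_nonneg (s := C))]
      exact mul_le_of_le_one_left (abs_nonneg _) measureReal_le_one
  rw [h2, hn'] at h1
  rw [Real.dist_eq]
  rw [abs_sub_comm] at h5
  have := abs_sub_le (μ.real (A ∩ τ n ⁻¹' B)) (μ.real C * μ.real D) (μ.real A * μ.real B)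
  linarith

/-- If no nonzero vector has a nonzero period, then the dual action is mixing. -/
theorem isMixing_dualAction [Fact p.Prime] [Countable M]
    {T : Multiplicative (Fin d → ℤ) →* Module.End (ZMod p) M}
    (hT : ∀ n m, T (.ofAdd n) m = m → n = 0 ∨ m = 0) : (dualAction T).IsMixing :=
  fun _ _ hA hB => tendsto_measure_inter_preimage_of_dense (S := {C | IsDualCylinder C})
    (τ := fun n => (dualAction T).toAut n)
    (fun n => ((dualAction T).toAut n).measurePreserving_haarProb)
    (fun _ hC => IsDualCylinder.isOpen hC |>.measurableSet)
    (fun _ hA _ hε => exists_isDualCylinder_measure_symmDiff_lt hA hε)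
    (fun _ hC _ hD => haarProb_inter_preimage_of_isDualCylinder hT hC hD) hA hB

end DualAction

/-! ### Orbit growth and zero entropy. -/

section DualEntropy

variable {p d : ℕ} {M : Type*} [AddCommGroup M] [Module (ZMod p) M]

/-- The part of the orbit of `w` over the box `{0, …, N - 1}^d` spans a space of dimension
`O(N^k)`. -/
def HasOrbitGrowth (T : Multiplicative (Fin d → ℤ) →* Module.End (ZMod p) M) (k : ℕ) (w : M) :
    Prop :=
  ∃ C : ℕ, ∀ N : ℕ, ∃ V : Submodule (ZMod p) M, Module.Finite (ZMod p) V ∧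
    Module.finrank (ZMod p) V ≤ C * (N + 1) ^ k ∧
    ∀ n : Fin d → Fin N, T (.ofAdd fun i => ((n i : ℕ) : ℤ)) w ∈ V

theorem exists_orbit_submodule_of_finset [Fact p.Prime]
    {T : Multiplicative (Fin d → ℤ) →* Module.End (ZMod p) M} {k : ℕ}
    (hT : ∀ w, HasOrbitGrowth T k w) (s : Finset M) :
    ∃ C : ℕ, ∀ N : ℕ, ∃ V : Submodule (ZMod p) M, Module.Finite (ZMod p) V ∧
      Module.finrank (ZMod p) V ≤ C * (N + 1) ^ k ∧
      ∀ w ∈ s, ∀ n : Fin d → Fin N, T (.ofAdd fun i => ((n i : ℕ) : ℤ)) w ∈ V := by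
  classical
  induction s using Finset.induction_on with
  | empty => exact ⟨0, fun N => ⟨⊥, inferInstance, by simp, by simp⟩⟩
  | insert a s _ ih =>
    obtain ⟨C, hC⟩ := ih
    obtain ⟨D, hD⟩ := hT a
    refine ⟨C + D, fun N => ?_⟩
    obtain ⟨V, hVf, hV, hVs⟩ := hC N
    obtain ⟨U, hUf, hU, hUa⟩ := hD N
    refine ⟨V ⊔ U, inferInstance, ?_, fun w hw n => ?_⟩
    · rw [add_mul]
      exact (Submodule.finrank_add_le_finrank_add_finrank V U).trans (add_le_add hV hU)
    · rcases Finset.mem_insert.1 hw with rfl | hw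
      · exact Submodule.mem_sup_right (hUa n)
      · exact Submodule.mem_sup_left (hVs w hw n)

/-- A finite measurable partition is approximated by partitions depending on finitely many
coordinates. -/
theorem exists_cylinder_partition [NeZero p] [Countable M]
    {μ : Measure (M →ₗ[ZMod p] ZMod p)} [IsFiniteMeasure μ] {k : ℕ}
    {P : (M →ₗ[ZMod p] ZMod p) → Fin k} (hP : Measurable P) {δ : ℝ} (hδ : 0 < δ) :
    ∃ (Q : (M →ₗ[ZMod p] ZMod p) → Fin k) (s : Finset M),
      (∀ χ χ' : M →ₗ[ZMod p] ZMod p, (∀ m ∈ s, χ m = χ' m) → Q χ = Q χ') ∧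
      μ.real {χ | P χ ≠ Q χ} < δ := by
  classical
  have hk : 0 < k := (P 0).pos
  have hδk : 0 < δ / k := by positivity
  have hex : ∀ i, ∃ C, IsDualCylinder C ∧ μ (symmDiff C (P ⁻¹' {i})) < ENNReal.ofReal (δ / k) :=
    fun i => exists_isDualCylinder_measure_symmDiff_lt (hP (measurableSet_singleton i))
      (ENNReal.ofReal_pos.2 hδk)
  choose C hC hCP using hex
  choose s hs using hC
  -- The label is chosen from the pattern of cylinder memberships alone, so it depends on finitely
  -- many coordinates. The default `P 0` and the arbitrary choice matter only where some `C i`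
  -- differs from its cell.
  let G : (Fin k → Prop) → Fin k := fun φ => if h : ∃ i, φ i then h.choose else P 0
  refine ⟨fun χ => G fun i => χ ∈ C i, Finset.univ.biUnion s, fun χ χ' h => ?_, ?_⟩
  · refine congrArg G (funext fun i => propext (hs i χ χ' fun m hm => h m ?_))
    exact Finset.mem_biUnion.2 ⟨i, Finset.mem_univ i, hm⟩
  · have hsub : {χ | P χ ≠ G fun i => χ ∈ C i} ⊆ ⋃ i, symmDiff (C i) (P ⁻¹' {i}) := by
      intro χ hχ
      by_contra hn
      refine hχ ?_
      have hi : ∀ i, χ ∈ C i ↔ P χ = i := by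
        intro i
        have := fun h => hn (Set.mem_iUnion.2 ⟨i, h⟩)
        rw [Set.mem_symmDiff] at this
        simp only [Set.mem_preimage, Set.mem_singleton_iff] at this
        tauto
      have h : ∃ i, χ ∈ C i := ⟨P χ, (hi _).2 rfl⟩
      change P χ = if h : ∃ i, χ ∈ C i then h.choose else P 0
      rw [dif_pos h]
      exact (hi _).1 h.choose_spec
    calc _ ≤ μ.real (⋃ i, symmDiff (C i) (P ⁻¹' {i})) := measureReal_mono hsub
      _ ≤ ∑ i, μ.real (symmDiff (C i) (P ⁻¹' {i})) := measureReal_iUnion_fintype_le _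
      _ < ∑ _i : Fin k, δ / k := Finset.sum_lt_sum_of_nonempty ⟨P 0, Finset.mem_univ _⟩
          fun i _ => (ENNReal.lt_ofReal_iff_toReal_lt (measure_ne_top _ _)).1 (hCP i)
      _ = δ := by
        rw [Finset.sum_const, Finset.card_univ, Fintype.card_fin, nsmul_eq_mul]
        field_simp

theorem measurable_of_cylinder_partition {k : ℕ} {Q : (M →ₗ[ZMod p] ZMod p) → Fin k}
    {s : Finset M} (hQ : ∀ χ χ' : M →ₗ[ZMod p] ZMod p, (∀ m ∈ s, χ m = χ' m) → Q χ = Q χ') :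
    Measurable Q :=
  measurable_to_countable' fun a => IsOpen.measurableSet <| IsDualCylinder.isOpen
    ⟨s, fun χ χ' h => by simp [hQ χ χ' h]⟩

theorem AlgebraicAction.measurable_refine {X : Type*} [AddCommGroup X] [TopologicalSpace X]
    [MeasurableSpace X] [BorelSpace X] (α : AlgebraicAction d X) {k : ℕ} {P : X → Fin k}
    (hP : Measurable P) (N : ℕ) : Measurable (α.refine P N) :=
  measurable_pi_lambda _ fun _ => hP.comp (α.toAut _).continuous.measurable

theorem AlgebraicAction.partitionEntropy_refine_le {X : Type*} [AddCommGroup X]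
    [TopologicalSpace X] [IsTopologicalAddGroup X] [CompactSpace X] [MeasurableSpace X]
    [BorelSpace X] (α : AlgebraicAction d X) {k : ℕ} {P : X → Fin k} (hP : Measurable P) (N : ℕ) :
    partitionEntropy (haarProb X) (α.refine P N) ≤
      (N : ℝ) ^ d * partitionEntropy (haarProb X) P := by
  refine (partitionEntropy_pi_le fun a =>
    α.measurable_refine hP N (measurableSet_singleton a)).trans_eq ?_
  calc _ = ∑ _n : Fin d → Fin N, partitionEntropy (haarProb X) P :=
        Finset.sum_congr rfl fun n _ => partitionEntropy_comp_measurePreserving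
          (fun a => hP (measurableSet_singleton a))
          (α.toAut fun i => ((n i : ℕ) : ℤ)).measurePreserving_haarProb
    _ = _ := by simp

/-- The entropies of the refinements of two partitions differ by at most the entropy of the
partition recording where they disagree. -/
theorem AlgebraicAction.partitionEntropy_refine_le_add {X : Type*} [AddCommGroup X]
    [TopologicalSpace X] [IsTopologicalAddGroup X] [CompactSpace X] [MeasurableSpace X]
    [BorelSpace X] (α : AlgebraicAction d X) {k : ℕ} {P Q : X → Fin k} (hP : Measurable P)
    (hQ : Measurable Q) (N : ℕ) :
    partitionEntropy (haarProb X) (α.refine P N) ≤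
      partitionEntropy (haarProb X) (α.refine Q N) + (N : ℝ) ^ d *
        partitionEntropy (haarProb X) fun x => if P x = Q x then 0 else (P x).succ := by
  have hE : Measurable fun x => if P x = Q x then 0 else (P x).succ :=
    (measurable_of_countable fun q : Fin k × Fin k => if q.1 = q.2 then 0 else q.1.succ).comp
      (hP.prodMk hQ)
  have hQN := α.measurable_refine hQ N
  have hEN := α.measurable_refine hE N
  refine le_trans ?_ ((partitionEntropy_prodMk_le
    (fun a => hQN (measurableSet_singleton a)) (fun a => hEN (measurableSet_singleton a))).trans
    (add_le_add_right (α.partitionEntropy_refine_le hE N) _))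
  -- The label of `Q` and the disagreement label determine that of `P`: `0` says they agree, and a
  -- successor records `P` itself.
  refine partitionEntropy_le_of_factors
    (fun a => (hQN.prodMk hEN) (measurableSet_singleton a)) fun x y h => ?_
  funext n
  have h1 := congrFun (Prod.ext_iff.1 h).1 n
  have h2 := congrFun (Prod.ext_iff.1 h).2 n
  simp only [AlgebraicAction.refine] at h1 h2 ⊢
  split_ifs at h2 with h3 h4 h4
  · rw [h3, h4, h1]
  · exact absurd h2.symm (Fin.succ_ne_zero _)
  · exact absurd h2 (Fin.succ_ne_zero _)
  · exact Fin.succ_injective _ h2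

/-- The refined label depends only on the restriction of `χ` to `V`, which has `p ^ finrank V`
possible values. -/
theorem partitionEntropy_refine_dualAction_le [Fact p.Prime]
    {T : Multiplicative (Fin d → ℤ) →* Module.End (ZMod p) M} {k : ℕ}
    {Q : (M →ₗ[ZMod p] ZMod p) → Fin k} {s : Finset M}
    (hQ : ∀ χ χ' : M →ₗ[ZMod p] ZMod p, (∀ m ∈ s, χ m = χ' m) → Q χ = Q χ') {N : ℕ}
    {V : Submodule (ZMod p) M} [Module.Finite (ZMod p) V]
    (hV : ∀ w ∈ s, ∀ n : Fin d → Fin N, T (.ofAdd fun i => ((n i : ℕ) : ℤ)) w ∈ V) :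
    partitionEntropy (haarProb _) ((dualAction T).refine Q N) ≤
      Module.finrank (ZMod p) V * Real.log p := by
  have : Finite (V →ₗ[ZMod p] ZMod p) := Module.finite_of_finite (ZMod p)
  have := Fintype.ofFinite (V →ₗ[ZMod p] ZMod p)
  have hR : Measurable fun χ : M →ₗ[ZMod p] ZMod p => χ ∘ₗ V.subtype :=
    (continuous_dual_comp V.subtype).measurable
  refine (partitionEntropy_le_of_factors (fun a => hR (measurableSet_singleton a))
    fun χ χ' h => funext fun n => hQ _ _ fun w hw => ?_).trans
    ((partitionEntropy_le_log_card fun a => hR (measurableSet_singleton a)).trans_eq ?_)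
  · exact LinearMap.congr_fun h ⟨_, hV w hw n⟩
  · rw [Module.card_eq_pow_finrank (K := ZMod p), ZMod.card]
    have : Module.finrank (ZMod p) (V →ₗ[ZMod p] ZMod p) = Module.finrank (ZMod p) V :=
      Subspace.dual_finrank_eq
    rw [this, Nat.cast_pow, Real.log_pow]

theorem tendsto_mul_succ_pow_div_pow {k : ℕ} (hk : k < d) (c : ℝ) (hc : 0 ≤ c) :
    Tendsto (fun N : ℕ => c * ((N : ℝ) + 1) ^ k / (N : ℝ) ^ d) atTop (𝓝 0) := by
  refine squeeze_zero' (Eventually.of_forall fun N => by positivity) ?_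
    (tendsto_const_div_atTop_nhds_zero_nat (c * 2 ^ k))
  filter_upwards [eventually_ge_atTop 1] with N hN
  have hN' : (1 : ℝ) ≤ N := by exact_mod_cast hN
  have h1 : ((N : ℝ) + 1) ^ k ≤ 2 ^ k * (N : ℝ) ^ k := by
    rw [← mul_pow]
    gcongr
    linarith
  have h2 : (N : ℝ) ^ k * N ≤ (N : ℝ) ^ d := by
    rw [← pow_succ]
    exact pow_le_pow_right₀ hN' hk
  rw [div_le_div_iff₀ (by positivity) (by positivity)]
  calc c * ((N : ℝ) + 1) ^ k * N ≤ c * (2 ^ k * (N : ℝ) ^ k) * N := by gcongr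
    _ = c * 2 ^ k * ((N : ℝ) ^ k * N) := by ring
    _ ≤ c * 2 ^ k * (N : ℝ) ^ d := by gcongr

/-- If all orbits in `M` have polynomial growth of degree less than `d`, then the dual action has
zero entropy. -/
theorem entropy_dualAction_eq_zero [Fact p.Prime] [Countable M]
    {T : Multiplicative (Fin d → ℤ) →* Module.End (ZMod p) M} {k : ℕ} (hk : k < d)
    (hT : ∀ w, HasOrbitGrowth T k w) : (dualAction T).entropy = 0 := by
  simp only [AlgebraicAction.entropy, ENNReal.iSup_eq_zero]
  intro l P hP
  refine Tendsto.limsup_eq ?_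
  rw [← ENNReal.ofReal_zero]
  refine ENNReal.tendsto_ofReal ?_
  set μ := haarProb (M →ₗ[ZMod p] ZMod p)
  refine tendsto_order.2 ⟨fun a ha => Eventually.of_forall fun N => ha.trans_le ?_,
    fun ε hε => ?_⟩
  · exact div_nonneg (partitionEntropy_nonneg _) (by positivity)
  -- Half of `ε` is spent on the disagreement of `P` with a cylinder partition `Q`, the other half
  -- on the refinement of `Q`.
  obtain ⟨δ, hδ, hδH⟩ := exists_pos_partitionEntropy_lt (Ω := M →ₗ[ZMod p] ZMod p) l (half_pos hε)
  obtain ⟨Q, s, hQ, hPQ⟩ := exists_cylinder_partition (μ := μ) hP hδ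
  have hQm := measurable_of_cylinder_partition hQ
  have hE : Measurable fun x => if P x = Q x then 0 else (P x).succ :=
    (measurable_of_countable fun q : Fin l × Fin l => if q.1 = q.2 then 0 else q.1.succ).comp
      (hP.prodMk hQm)
  have hHE := hδH μ (fun x => if P x = Q x then 0 else (P x).succ)
    (fun a => hE (measurableSet_singleton a)) (by
      refine lt_of_eq_of_lt (congrArg μ.real ?_) hPQ
      ext x
      simp)
  obtain ⟨C, hC⟩ := exists_orbit_submodule_of_finset hT s
  have hlog : 0 ≤ Real.log p := Real.log_natCast_nonneg p
  filter_upwards [(tendsto_order.1 (tendsto_mul_succ_pow_div_pow hk (C * Real.log p)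
    (by positivity))).2 (ε / 2) (half_pos hε), eventually_ge_atTop 1] with N hN hN1
  have hN0 : (0 : ℝ) < (N : ℝ) ^ d := by
    have : (0 : ℝ) < N := by exact_mod_cast hN1
    positivity
  obtain ⟨V, hVf, hV, hVs⟩ := hC N
  have hV' : (Module.finrank (ZMod p) V : ℝ) ≤ C * ((N : ℝ) + 1) ^ k := by exact_mod_cast hV
  have h1 := (dualAction T).partitionEntropy_refine_le_add hP hQm N
  have h2 := partitionEntropy_refine_dualAction_le hQ hVs
  have h3 := mul_le_mul_of_nonneg_right hV' hlog
  rw [div_lt_iff₀ hN0] at hN ⊢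
  have h4 := mul_lt_mul_of_pos_left hHE hN0
  linarith

end DualEntropy

/-! ### The module `V × (V ⊗ V)` and the quadratic shear. -/

section TensorSquare

open scoped TensorProduct

variable {p d : ℕ} {V : Type*} [AddCommGroup V] [Module (ZMod p) V]

instance TensorProduct.countable {R M N : Type*} [CommSemiring R] [AddCommMonoid M]
    [AddCommMonoid N] [Module R M] [Module R N] [Countable M] [Countable N] :
    Countable (M ⊗[R] N) := by
  have : Countable (FreeAddMonoid (M × N)) := inferInstanceAs (Countable (List (M × N)))
  exact Quotient.countable

/-- The action on `V × V ⊗ V` induced by an action on `V`. -/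
noncomputable def tensorSquareRep (T : Multiplicative (Fin d → ℤ) →* Module.End (ZMod p) V) :
    Multiplicative (Fin d → ℤ) →* Module.End (ZMod p) (V × (V ⊗[ZMod p] V)) where
  toFun n := (T n).prodMap (TensorProduct.map (T n) (T n))
  map_one' := by
    rw [map_one, TensorProduct.map_one, LinearMap.prodMap_one]
  map_mul' m n := by
    rw [map_mul, TensorProduct.map_mul, LinearMap.prodMap_mul]

theorem tensorSquareRep_apply (T : Multiplicative (Fin d → ℤ) →* Module.End (ZMod p) V)
    (n : Multiplicative (Fin d → ℤ)) (x : V × (V ⊗[ZMod p] V)) :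
    tensorSquareRep T n x = (T n x.1, TensorProduct.map (T n) (T n) x.2) :=
  rfl

/-- Contraction of the second tensor factor by a functional. -/
noncomputable def tensorContract (ψ : V →ₗ[ZMod p] ZMod p) : V ⊗[ZMod p] V →ₗ[ZMod p] V :=
  (TensorProduct.rid (ZMod p) V).toLinearMap ∘ₗ ψ.lTensor V

theorem tensorContract_tmul (ψ : V →ₗ[ZMod p] ZMod p) (a b : V) :
    tensorContract ψ (a ⊗ₜ b) = ψ b • a := by
  simp [tensorContract]

theorem tensorContract_map (ψ : V →ₗ[ZMod p] ZMod p) (S T : Module.End (ZMod p) V)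
    (w : V ⊗[ZMod p] V) :
    tensorContract ψ (TensorProduct.map S T w) = S (tensorContract (ψ ∘ₗ T) w) := by
  induction w with
  | zero => simp
  | tmul a b => simp [tensorContract_tmul]
  | add x y hx hy => simp only [map_add, hx, hy]

theorem eq_zero_of_forall_tensorContract [Fact p.Prime] {w : V ⊗[ZMod p] V}
    (h : ∀ ψ, tensorContract ψ w = 0) : w = 0 := by
  classical
  let b := Module.Basis.ofVectorSpace (ZMod p) V
  refine (TensorProduct.equivFinsuppOfBasisRight b).injective ?_
  rw [map_zero]
  ext i
  rw [Finsupp.zero_apply, ← h (b.coord i)]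
  clear h
  induction w with
  | zero => simp
  | tmul x y => simp [tensorContract_tmul]
  | add x y hx hy => simp only [map_add, Finsupp.add_apply, hx, hy]

/-- A tensor is a finite sum of pure tensors, and contracting `a ⊗ b` gives one of the finitely many
`𝔽_p`-multiples of `a`. -/
theorem finite_range_tensorContract [Fact p.Prime] (w : V ⊗[ZMod p] V) :
    (Set.range fun ψ => tensorContract ψ w).Finite := by
  induction w with
  | zero => exact (Set.finite_singleton 0).subset (by rintro _ ⟨ψ, rfl⟩; simp)
  | tmul a b =>
    refine (Set.finite_range fun c : ZMod p => c • a).subset ?_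
    rintro _ ⟨ψ, rfl⟩
    exact ⟨ψ b, (tensorContract_tmul ψ a b).symm⟩
  | add x y hx hy =>
    refine (Set.Finite.add hx hy).subset ?_
    rintro _ ⟨ψ, rfl⟩
    exact ⟨_, ⟨ψ, rfl⟩, _, ⟨ψ, rfl⟩, (map_add _ _ _).symm⟩

/-- If `n ≠ 0` fixed `w` and `ψ` contracted `w` to `u ≠ 0`, then every `T (-k n) u` would again be a
contraction of `w`, by `ψ ∘ T (k n)`. Infinitely many group elements would return `u` to a finite
set, which freeness on `V` forbids. -/
theorem eq_zero_of_tensorMap_eq [Fact p.Prime]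
    {T : Multiplicative (Fin d → ℤ) →* Module.End (ZMod p) V}
    (hT : ∀ n v, T (.ofAdd n) v = v → n = 0 ∨ v = 0) (n : Fin d → ℤ) (w : V ⊗[ZMod p] V)
    (hw : TensorProduct.map (T (.ofAdd n)) (T (.ofAdd n)) w = w) : n = 0 ∨ w = 0 := by
  refine or_iff_not_imp_left.2 fun hn => eq_zero_of_forall_tensorContract fun ψ => ?_
  by_contra h0
  have hfin := finite_setOf_not_disjoint_image hT (finite_range_tensorContract w)
  have hiter : ∀ k : ℕ, TensorProduct.map (T (.ofAdd (k • n))) (T (.ofAdd (k • n))) w = w := by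
    intro k
    induction k with
    | zero =>
      rw [zero_smul, ofAdd_zero, map_one, TensorProduct.map_one]
      rfl
    | succ k ih =>
      rw [succ_nsmul, ofAdd_add, map_mul, TensorProduct.map_mul, Module.End.mul_apply, hw, ih]
  have hinj : Function.Injective fun k : ℕ => -(k • n) := by
    intro k l hkl
    have h1 : ((k : ℤ) - l) • n = 0 := by
      rw [sub_smul, natCast_zsmul, natCast_zsmul, sub_eq_zero]
      exact neg_injective hkl
    have := (smul_eq_zero.1 h1).resolve_right hn
    omega
  refine Set.infinite_range_of_injective hinj (hfin.subset ?_)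
  rintro _ ⟨k, rfl⟩
  refine ⟨tensorContract ψ w, ⟨ψ, rfl⟩, h0, ψ ∘ₗ T (.ofAdd (k • n)), ?_⟩
  have h1 := tensorContract_map ψ (T (.ofAdd (k • n))) (T (.ofAdd (k • n))) w
  rw [hiter] at h1
  change tensorContract (ψ ∘ₗ T (.ofAdd (k • n))) w = T (.ofAdd (-(k • n))) (tensorContract ψ w)
  rw [h1, ← Module.End.mul_apply, ← map_mul, ← ofAdd_add]
  simp

theorem tensorSquareRep_eq_zero [Fact p.Prime]
    {T : Multiplicative (Fin d → ℤ) →* Module.End (ZMod p) V}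
    (hT : ∀ n v, T (.ofAdd n) v = v → n = 0 ∨ v = 0) (n : Fin d → ℤ) (x : V × (V ⊗[ZMod p] V))
    (hx : tensorSquareRep T (.ofAdd n) x = x) : n = 0 ∨ x = 0 := by
  rw [tensorSquareRep_apply] at hx
  have h1 := hT n x.1 (congrArg Prod.fst hx)
  have h2 := eq_zero_of_tensorMap_eq hT n x.2 (congrArg Prod.snd hx)
  rw [Prod.ext_iff, Prod.fst_zero, Prod.snd_zero]
  tauto

theorem HasOrbitGrowth.add [Fact p.Prime]
    {T : Multiplicative (Fin d → ℤ) →* Module.End (ZMod p) V} {k : ℕ} {x y : V}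
    (hx : HasOrbitGrowth T k x) (hy : HasOrbitGrowth T k y) : HasOrbitGrowth T k (x + y) := by
  obtain ⟨C, hC⟩ := hx
  obtain ⟨D, hD⟩ := hy
  refine ⟨C + D, fun N => ?_⟩
  obtain ⟨A, _, hA, hAx⟩ := hC N
  obtain ⟨B, _, hB, hBy⟩ := hD N
  refine ⟨A ⊔ B, inferInstance, ?_, fun n => ?_⟩
  · rw [add_mul]
    exact (Submodule.finrank_add_le_finrank_add_finrank A B).trans (add_le_add hA hB)
  · rw [map_add]
    exact add_mem (Submodule.mem_sup_left (hAx n)) (Submodule.mem_sup_right (hBy n))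

theorem HasOrbitGrowth.mono {T : Multiplicative (Fin d → ℤ) →* Module.End (ZMod p) V} {k l : ℕ}
    (hkl : k ≤ l) {x : V} (hx : HasOrbitGrowth T k x) : HasOrbitGrowth T l x := by
  obtain ⟨C, hC⟩ := hx
  refine ⟨C, fun N => ?_⟩
  obtain ⟨A, hf, hA, hAx⟩ := hC N
  exact ⟨A, hf, hA.trans (Nat.mul_le_mul_left _ (Nat.pow_le_pow_right N.succ_pos hkl)), hAx⟩

theorem HasOrbitGrowth.map [Fact p.Prime] {W : Type*} [AddCommGroup W] [Module (ZMod p) W]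
    {T : Multiplicative (Fin d → ℤ) →* Module.End (ZMod p) V}
    {S : Multiplicative (Fin d → ℤ) →* Module.End (ZMod p) W} {k : ℕ} {x : V}
    (hx : HasOrbitGrowth T k x) (f : V →ₗ[ZMod p] W) (hf : ∀ n, f (T n x) = S n (f x)) :
    HasOrbitGrowth S k (f x) := by
  obtain ⟨C, hC⟩ := hx
  refine ⟨C, fun N => ?_⟩
  obtain ⟨A, _, hA, hAx⟩ := hC N
  exact ⟨A.map f, inferInstance, (Submodule.finrank_map_le f A).trans hA,
    fun n => hf _ ▸ Submodule.mem_map_of_mem (hAx n)⟩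

theorem hasOrbitGrowth_tensorSquareRep [Fact p.Prime]
    {T : Multiplicative (Fin d → ℤ) →* Module.End (ZMod p) V}
    (hT : ∀ v, HasOrbitGrowth T 1 v) (x : V × (V ⊗[ZMod p] V)) :
    HasOrbitGrowth (tensorSquareRep T) 2 x := by
  obtain ⟨v, w⟩ := x
  rw [← Prod.fst_add_snd (v, w)]
  refine HasOrbitGrowth.add ?_ ?_
  · exact ((hT v).map (S := tensorSquareRep T) (LinearMap.inl (ZMod p) V (V ⊗[ZMod p] V))
      fun n => by simp [tensorSquareRep_apply]).mono one_le_two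
  · change HasOrbitGrowth (tensorSquareRep T) 2 (0, w)
    induction w with
    | zero => exact ⟨0, fun N => ⟨⊥, inferInstance, by simp, by simp [tensorSquareRep_apply]⟩⟩
    | add x y hx hy =>
      have := hx.add hy
      rwa [Prod.mk_add_mk, add_zero] at this
    | tmul a b =>
      obtain ⟨C, hC⟩ := hT a
      obtain ⟨D, hD⟩ := hT b
      refine ⟨C * D, fun N => ?_⟩
      obtain ⟨A, _, hA, hAa⟩ := hC N
      obtain ⟨B, _, hB, hBb⟩ := hD N
      -- The orbit of `a ⊗ b` stays in the image of `A ⊗ B`, whose dimension is at most the product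
      -- of two linear bounds.
      refine ⟨LinearMap.range (LinearMap.inr (ZMod p) V (V ⊗[ZMod p] V) ∘ₗ
        TensorProduct.map A.subtype B.subtype), inferInstance, ?_, fun n => ?_⟩
      · refine (LinearMap.finrank_range_le _).trans ?_
        rw [Module.finrank_tensorProduct]
        calc _ ≤ C * (N + 1) ^ 1 * (D * (N + 1) ^ 1) := Nat.mul_le_mul hA hB
          _ = _ := by ring
      · exact ⟨⟨_, hAa n⟩ ⊗ₜ ⟨_, hBb n⟩, by simp [tensorSquareRep_apply]⟩

/-- The quadratic map sending a functional to its tensor square. -/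
noncomputable def dualSquare (χ : V →ₗ[ZMod p] ZMod p) : V ⊗[ZMod p] V →ₗ[ZMod p] ZMod p :=
  LinearMap.mul' (ZMod p) (ZMod p) ∘ₗ TensorProduct.map χ χ

theorem dualSquare_tmul (χ : V →ₗ[ZMod p] ZMod p) (a b : V) :
    dualSquare χ (a ⊗ₜ b) = χ a * χ b := by
  simp [dualSquare]

theorem continuous_dualSquare :
    Continuous (dualSquare : (V →ₗ[ZMod p] ZMod p) → V ⊗[ZMod p] V →ₗ[ZMod p] ZMod p) := by
  refine continuous_dual_iff.2 fun w => ?_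
  induction w with
  | zero => simpa using continuous_const
  | tmul a b =>
    simp only [dualSquare_tmul]
    exact (continuous_dual_apply a).mul (continuous_dual_apply b)
  | add x y hx hy =>
    simp only [map_add]
    exact hx.add hy

theorem dualSquare_comp (χ : V →ₗ[ZMod p] ZMod p) (T : Module.End (ZMod p) V) :
    dualSquare (χ ∘ₗ T) = dualSquare χ ∘ₗ TensorProduct.map T T := by
  rw [dualSquare, dualSquare, LinearMap.comp_assoc, ← TensorProduct.map_comp]

/-- The quadratic shear `(χ, β) ↦ (χ, β + χ ⊗ χ)` of the dual of `V × V ⊗ V`. -/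
noncomputable def quadraticShear (p : ℕ) (V : Type*) [AddCommGroup V] [Module (ZMod p) V] :
    (V × (V ⊗[ZMod p] V) →ₗ[ZMod p] ZMod p) ≃ₜ (V × (V ⊗[ZMod p] V) →ₗ[ZMod p] ZMod p) where
  toFun χ := χ + dualSquare (χ ∘ₗ LinearMap.inl _ _ _) ∘ₗ LinearMap.snd _ _ _
  invFun χ := χ - dualSquare (χ ∘ₗ LinearMap.inl _ _ _) ∘ₗ LinearMap.snd _ _ _
  -- The correction vanishes on the summand `V`, so both maps subtract or add the same square.
  left_inv χ := by
    dsimp only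
    rw [LinearMap.add_comp, LinearMap.comp_assoc _ _ (dualSquare _), LinearMap.snd_comp_inl,
      LinearMap.comp_zero, add_zero, add_sub_cancel_right]
  right_inv χ := by
    dsimp only
    rw [LinearMap.sub_comp, LinearMap.comp_assoc _ _ (dualSquare _), LinearMap.snd_comp_inl,
      LinearMap.comp_zero, sub_zero, sub_add_cancel]
  continuous_toFun := continuous_id.add <| (continuous_dual_comp _).comp <|
    continuous_dualSquare.comp (continuous_dual_comp _)
  continuous_invFun := continuous_id.sub <| (continuous_dual_comp _).comp <|
    continuous_dualSquare.comp (continuous_dual_comp _)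

theorem quadraticShear_apply (χ : V × (V ⊗[ZMod p] V) →ₗ[ZMod p] ZMod p) :
    quadraticShear p V χ =
      χ + dualSquare (χ ∘ₗ LinearMap.inl _ _ _) ∘ₗ LinearMap.snd _ _ _ :=
  rfl

theorem quadraticShear_equivariant (T : Multiplicative (Fin d → ℤ) →* Module.End (ZMod p) V)
    (n : Fin d → ℤ) (χ : V × (V ⊗[ZMod p] V) →ₗ[ZMod p] ZMod p) :
    quadraticShear p V ((dualAction (tensorSquareRep T)).toAut n χ) =
      (dualAction (tensorSquareRep T)).toAut n (quadraticShear p V χ) := by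
  have h : (dualAction (tensorSquareRep T)).toAut n χ ∘ₗ LinearMap.inl _ _ _ =
      (χ ∘ₗ LinearMap.inl _ _ _) ∘ₗ T (.ofAdd n) := by
    ext v
    simp [dualAction_toAut_apply, tensorSquareRep_apply]
  refine LinearMap.ext fun x => ?_
  rw [quadraticShear_apply, h, dualSquare_comp, dualAction_toAut_apply, quadraticShear_apply]
  rfl

theorem measurePreserving_quadraticShear [Fact p.Prime] [Countable V] :
    MeasurePreserving (quadraticShear p V) (haarProb _) (haarProb _) := by
  let j : (V ⊗[ZMod p] V →ₗ[ZMod p] ZMod p) →+ (V × (V ⊗[ZMod p] V) →ₗ[ZMod p] ZMod p) :=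
    { toFun := fun β => β ∘ₗ LinearMap.snd _ _ _
      map_zero' := LinearMap.zero_comp _
      map_add' := fun _ _ => rfl }
  refine measurePreserving_skewTranslation j (continuous_dual_comp _)
    (fun χ => dualSquare (χ ∘ₗ LinearMap.inl _ _ _))
    (continuous_dualSquare.comp (continuous_dual_comp _)) fun χ β => ?_
  change dualSquare ((χ + β ∘ₗ LinearMap.snd _ _ _) ∘ₗ LinearMap.inl _ _ _) = _
  rw [LinearMap.add_comp, LinearMap.comp_assoc _ _ β, LinearMap.snd_comp_inl,
    LinearMap.comp_zero, add_zero]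

theorem not_isAffineMap_quadraticShear [Fact p.Prime] (hp : p ≠ 2) [Nontrivial V] :
    ¬ IsAffineMap (quadraticShear p V) := by
  rintro ⟨c, θ, -, hae⟩
  -- Haar measure charges nonempty open sets, so continuous maps equal almost everywhere are equal.
  have heq : (quadraticShear p V : _ → _) = fun χ => c + θ χ :=
    Continuous.ae_eq_iff_eq _ (quadraticShear p V).continuous
      (continuous_const.add θ.continuous_toFun) |>.1 hae
  obtain ⟨v, hv⟩ := exists_ne (0 : V)
  obtain ⟨φ, hφ⟩ := Module.Projective.exists_dual_ne_zero (ZMod p) hv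
  set χ : V × (V ⊗[ZMod p] V) →ₗ[ZMod p] ZMod p := φ ∘ₗ LinearMap.fst _ _ _
  have h0 := DFunLike.congr_fun (congrFun heq 0) ((0, v ⊗ₜ v) : V × (V ⊗[ZMod p] V))
  have h1 := DFunLike.congr_fun (congrFun heq χ) ((0, v ⊗ₜ v) : V × (V ⊗[ZMod p] V))
  have h2 := DFunLike.congr_fun (congrFun heq (χ + χ)) ((0, v ⊗ₜ v) : V × (V ⊗[ZMod p] V))
  simp only [map_zero, map_add] at h0 h1 h2
  simp only [quadraticShear_apply, LinearMap.add_apply, LinearMap.comp_apply,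
    LinearMap.snd_apply, dualSquare_tmul, LinearMap.inl_apply, LinearMap.zero_apply,
    LinearMap.fst_apply, map_zero, χ] at h0 h1 h2
  -- The second difference `f (2χ) - 2 f χ + f 0` vanishes for an affine map, but here equals `2
  -- φ(v)²` at `v ⊗ v`.
  have h3 : (2 : ZMod p) * (φ v * φ v) = 0 := by linear_combination h2 - 2 * h1 + h0
  have h4 : (2 : ZMod p) ≠ 0 := by
    intro h
    have : (p : ℕ) ∣ 2 := (ZMod.natCast_eq_zero_iff 2 p).1 (by exact_mod_cast h)
    exact hp ((Nat.prime_dvd_prime_iff_eq Fact.out Nat.prime_two).1 this)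
  exact mul_ne_zero h4 (mul_ne_zero hφ hφ) h3

end TensorSquare

/-! ### The action on `𝔽_p(t)` by linear factors. -/

section LinearFactors

open Polynomial

variable {p d : ℕ} [Fact p.Prime]

theorem RatFunc.countable (F : Type*) [Field F] [Countable F] : Countable (RatFunc F) := by
  have : Countable F[X] := Cardinal.mk_le_aleph0_iff.1 <|
    Polynomial.cardinalMk_le_max.trans (max_le (Cardinal.mk_le_aleph0_iff.2 ‹_›) le_rfl)
  refine Function.Surjective.countable
    (f := fun q : F[X] × F[X] => algebraMap F[X] (RatFunc F) q.1 / algebraMap F[X] (RatFunc F) q.2)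
    fun x => ⟨(x.num, x.denom), x.num_div_denom⟩

theorem count_roots_prod_X_sub_C_pow {F ι : Type*} [Field F] [DecidableEq F] [Fintype ι]
    {c : ι → F} (hc : Function.Injective c) (a : ι → ℕ) (j : ι) :
    (∏ i, (X - C (c i)) ^ a i).roots.count (c j) = a j := by
  classical
  rw [roots_prod _ _ (Finset.prod_ne_zero_iff.2 fun i _ => pow_ne_zero _ (X_sub_C_ne_zero _)),
    Multiset.count_bind]
  simp only [roots_pow, roots_X_sub_C, Multiset.count_nsmul, Multiset.count_singleton]
  simp [Finset.sum_map_val, hc.eq_iff]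

/-- The linear factor `t - i`, as a unit of the field of rational functions over `𝔽_p`. -/
noncomputable def linearFactorUnit (p : ℕ) [Fact p.Prime] (i : ℕ) : (RatFunc (ZMod p))ˣ :=
  Units.mk0 (algebraMap (ZMod p)[X] _ (X - C (i : ZMod p)))
    ((map_ne_zero_iff _ (RatFunc.algebraMap_injective _)).2 (X_sub_C_ne_zero _))

/-- The homomorphism from `ℤ^d` to the rational functions sending the basis vectors to distinct
linear factors. -/
noncomputable def linearFactorHom (p d : ℕ) [Fact p.Prime] :
    Multiplicative (Fin d → ℤ) →* (RatFunc (ZMod p))ˣ where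
  toFun n := ∏ i : Fin d, linearFactorUnit p i ^ (n.toAdd i)
  map_one' := by simp
  map_mul' m n := by simp [zpow_add, Finset.prod_mul_distrib]

theorem linearFactorHom_natCast (a : Fin d → ℕ) :
    (linearFactorHom p d (.ofAdd fun i => (a i : ℤ)) : RatFunc (ZMod p)) =
      algebraMap (ZMod p)[X] _ (∏ i : Fin d, (X - C ((i : ℕ) : ZMod p)) ^ a i) := by
  simp [linearFactorHom, linearFactorUnit]

theorem injective_fin_natCast_zmod (hp : d ≤ p) :
    Function.Injective fun i : Fin d => ((i : ℕ) : ZMod p) := by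
  intro i j h
  have := (ZMod.natCast_eq_natCast_iff _ _ _).1 h
  exact Fin.ext (Nat.ModEq.eq_of_lt_of_lt this (i.2.trans_le hp) (j.2.trans_le hp))

/-- Split `n` into positive and negative parts to get an equality of polynomials, then compare
multiplicities at the roots `i`, which are distinct in `𝔽_p` because `d ≤ p`. -/
theorem eq_zero_of_linearFactorHom_eq_one (hp : d ≤ p) {n : Fin d → ℤ}
    (h : linearFactorHom p d (.ofAdd n) = 1) : n = 0 := by
  have hn : n = (fun i => ((n i).toNat : ℤ)) - fun i => ((-n i).toNat : ℤ) := by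
    funext i
    simp only [Pi.sub_apply]
    omega
  rw [hn, ofAdd_sub, _root_.map_div, div_eq_one, ← Units.val_inj, linearFactorHom_natCast,
    linearFactorHom_natCast] at h
  have h' := RatFunc.algebraMap_injective _ h
  have hc := injective_fin_natCast_zmod hp
  funext j
  have h1 := count_roots_prod_X_sub_C_pow hc (fun i => (n i).toNat) j
  have h2 := count_roots_prod_X_sub_C_pow hc (fun i => (-n i).toNat) j
  rw [← h', h1] at h2
  simp only [Pi.zero_apply]
  omega

/-- The action of `ℤ^d` on the field of rational functions by multiplication by products of linear
factors. -/
noncomputable def linearFactorRep (p d : ℕ) [Fact p.Prime] :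
    Multiplicative (Fin d → ℤ) →* Module.End (ZMod p) (RatFunc (ZMod p)) :=
  ((Algebra.lmul (ZMod p) (RatFunc (ZMod p)) : _ →* _).comp (Units.coeHom _)).comp
    (linearFactorHom p d)

theorem linearFactorRep_apply (n : Multiplicative (Fin d → ℤ)) (x : RatFunc (ZMod p)) :
    linearFactorRep p d n x = linearFactorHom p d n * x :=
  rfl

theorem linearFactorRep_eq_zero (hp : d ≤ p) (n : Fin d → ℤ) (x : RatFunc (ZMod p))
    (h : linearFactorRep p d (.ofAdd n) x = x) : n = 0 ∨ x = 0 := by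
  refine or_iff_not_imp_right.2 fun hx => eq_zero_of_linearFactorHom_eq_one hp (Units.ext ?_)
  rw [linearFactorRep_apply] at h
  exact mul_right_cancel₀ hx (h.trans (one_mul x).symm)

theorem natDegree_prod_X_sub_C_pow_le {F : Type*} [Field F] (c : Fin d → F) {N : ℕ}
    (n : Fin d → Fin N) : (∏ i, (X - C (c i)) ^ (n i : ℕ)).natDegree ≤ d * N := by
  refine (natDegree_prod_le _ _).trans ?_
  calc _ ≤ ∑ _i : Fin d, N := Finset.sum_le_sum fun i _ => by
        simp
    _ = d * N := by simp

/-- All multiples share the denominator of `x`, while over the box the numerator's degree rises by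
at most `d * N`. -/
theorem hasOrbitGrowth_linearFactorRep (x : RatFunc (ZMod p)) :
    HasOrbitGrowth (linearFactorRep p d) 1 x := by
  let ι : (ZMod p)[X] →ₗ[ZMod p] RatFunc (ZMod p) :=
    LinearMap.mulRight (ZMod p) (algebraMap (ZMod p)[X] _ x.denom)⁻¹ ∘ₗ
      (IsScalarTower.toAlgHom (ZMod p) (ZMod p)[X] (RatFunc (ZMod p))).toLinearMap
  refine ⟨x.num.natDegree + 1 + d, fun N => ⟨(degreeLT (ZMod p) (x.num.natDegree + 1 + d * N)).map ι,
    ?_, ?_, fun n => ?_⟩⟩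
  · have := Module.Finite.equiv (degreeLTEquiv (ZMod p) (x.num.natDegree + 1 + d * N)).symm
    infer_instance
  · have := Module.Finite.equiv (degreeLTEquiv (ZMod p) (x.num.natDegree + 1 + d * N)).symm
    refine (Submodule.finrank_map_le ι _).trans ?_
    rw [(degreeLTEquiv (ZMod p) _).finrank_eq, Module.finrank_fin_fun]
    nlinarith
  · refine ⟨(∏ i : Fin d, (X - C ((i : ℕ) : ZMod p)) ^ (n i : ℕ)) * x.num, ?_, ?_⟩
    · rw [SetLike.mem_coe, mem_degreeLT]
      refine degree_le_natDegree.trans_lt (Nat.cast_lt.2 (natDegree_mul_le.trans_lt ?_))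
      have := natDegree_prod_X_sub_C_pow_le (fun i : Fin d => ((i : ℕ) : ZMod p)) n
      omega
    · rw [linearFactorRep_apply, linearFactorHom_natCast (fun i => (n i : ℕ))]
      change algebraMap (ZMod p)[X] (RatFunc (ZMod p)) _ * (algebraMap _ _ x.denom)⁻¹ = _
      rw [map_mul, mul_assoc, ← div_eq_mul_inv, x.num_div_denom]

end LinearFactors

/-! ### The counterexample to isomorphism rigidity. -/

theorem theorem1p1 (d : ℕ) (hd : 8 ≤ d) :
    (∃ (X : Type) (_ : AddCommGroup X) (_ : TopologicalSpace X) (_ : IsTopologicalAddGroup X)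
      (_ : CompactSpace X) (_ : T2Space X) (_ : MeasurableSpace X) (_ : BorelSpace X)
      (α : AlgebraicAction d X) (f : X ≃ₜ X),
      IsZeroDimensional X ∧ α.IsMixing ∧ α.entropy = 0 ∧
      ¬ IsAffineMap f ∧
      MeasurePreserving f (haarProb X) (haarProb X) ∧
      ∀ (n : Fin d → ℤ) (x : X), f (α.toAut n x) = α.toAut n (f x)) ∧
    ¬ IsomorphismRigidity d := by
  -- Taking `p ≥ d` gives `d` distinct residues and makes `p` odd. The growth exponent `2` lies
  -- below `d`; the same argument works from `d = 3` on.
  obtain ⟨p, hdp, hp⟩ := Nat.exists_infinite_primes d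
  have : Fact p.Prime := ⟨hp⟩
  have := RatFunc.countable (ZMod p)
  have hmix := isMixing_dualAction (tensorSquareRep_eq_zero (linearFactorRep_eq_zero hdp))
  have hent := entropy_dualAction_eq_zero (by omega : 2 < d)
    (hasOrbitGrowth_tensorSquareRep (hasOrbitGrowth_linearFactorRep (p := p)))
  have haff := not_isAffineMap_quadraticShear (p := p) (V := RatFunc (ZMod p)) (by omega)
  have hpres := measurePreserving_quadraticShear (p := p) (V := RatFunc (ZMod p))
  have hequiv := quadraticShear_equivariant (linearFactorRep p d)
  refine ⟨⟨_, _, _, inferInstance, inferInstance, inferInstance, _, inferInstance, _, _,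
    isZeroDimensional_dual, hmix, hent, haff, hpres, hequiv⟩, fun H => haff ?_⟩
  -- Rigidity is tested with both actions equal and the shear as a self-conjugacy.
  refine H _ _ _ _ hmix hmix hent _ ⟨hpres, ⟨(quadraticShear p (RatFunc (ZMod p))).symm,
    (quadraticShear p (RatFunc (ZMod p))).symm.continuous.measurable, ?_, ?_⟩, ?_⟩
  · exact Eventually.of_forall (quadraticShear p (RatFunc (ZMod p))).symm_apply_apply
  · exact Eventually.of_forall (quadraticShear p (RatFunc (ZMod p))).apply_symm_apply
  · exact fun n => Eventually.of_forall (hequiv n)
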